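/- **Setting.** Let $M$ be a finite set of agents (write $M$ also for their number). A fixed-action-set linear bandit instance $I$ consists of a parameter $\theta^*\in\mathbb{R}^d$, a non-empty finite action set $X\subset\mathbb{R}^d$, $|X|=K$, available to every agent at every time, and a zero-mean sub-Gaussian noise law: an agent $a$ who plays $x\in X$ at time $t$ observes $\langle\theta^*,x\rangle+\eta_{a,t}$, the $\eta_{a,t}$ being i.i.d. with that law. Let $\Delta=\max_{x\in X}\bigl(\max_{x'\in X}\langle\theta^*,x'\rangle-\langle\theta^*,x\rangle\bigr)$ be the largest sub-optimality gap. Let $\mathrm{Sin}$ be a (possibly randomized) single-agent bandit algorithm on $X$, i.e. a rule that chooses the next action from the history of its actions and rewards, and let $R(t)$ be its expected pseudo-regret on $I$ after $t$ steps, i.e. $R(t)=\sum_{s=1}^{t}\bigl(\max_{x\in X}\langle\theta^*,x\rangle-\mathbb{E}\langle\theta^*,x_s\rangle\bigr)$. For a coalition $C\subseteq M$ the multi-agent algorithm $\mathrm{Mul}$ runs as follows. It keeps a reward buffer $B_x$ for every $x\in X$ (initially empty) and a simulated history of $\mathrm{Sin}$ (initially empty); let $\bar x$ be the first action of $\mathrm{Sin}$.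 At each time $t=1,\dots,T$ all agents of $C$ play $\bar x$, and $B_{\bar x}$ is replaced by the rewards they observe; then, as long as $B_{\bar x}\neq\emptyset$, one reward is removed from $B_{\bar x}$ (by an arbitrary rule that does not look at the reward values), the pair of $\bar x$ and that reward is appended to the simulated history, and $\bar x$ becomes the next action of $\mathrm{Sin}$ on that history. Let $R^C_a(\mathrm{Mul},I,T)=\sum_{t=1}^{T}\bigl(\max_{x\in X}\langle\theta^*,x\rangle-\mathbb{E}\langle\theta^*,x_{a,t}\rangle\bigr)$ be the expected regret of $a\in C$, and let $v(C)=v_{\mathrm{Mul},I,T}(C)=-\sum_{a\in C}R^C_a(\mathrm{Mul},I,T)$. For integers $t\ge 0$ and $g,h\ge 1$ put $R'(t,h)=\frac{R(t+h)-R(t)}{h}$ and $R''(t,g,h)=\frac{R'(t+g,h)-R'(t,h)}{g}$. **Corollary.** Let $T\ge 0$ be a time horizon. Suppose that there are numbers $\upsilon_t>0$ ($0\le t\le MT-2$), $c\in\mathbb{R}$ and $\varepsilon>0$ such that, for all integers $t\ge0$, $g,h\ge1$ with $t+g+h\le MT$, $$R''(t,g,h)\le-\upsilon_t\qquad\text{and,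 if } t\ge 1,\qquad R''(t,g,h)\ge -c\,t^{-2+\varepsilon},$$ and that $T$ is sufficiently large in the sense that $$T\;\ge\;\sqrt{\frac{4MK\Delta}{\upsilon_t}}\qquad\text{for all } 0\le t\le MT-2 .$$ Then the core of the collaboration game $(M,v_{\mathrm{Mul},I,T})$, i.e. $\{p\in\mathbb{R}^M:\sum_{i\in M}p_i=v(M),\ \sum_{i\in C}p_i\ge v(C)\ \text{for all } C\subseteq M\}$, is non-empty, and the Shapley value $$\phi_i(v)=\frac1M\sum_{S\subseteq M\setminus\{i\}}\binom{M-1}{|S|}^{-1}\bigl(v(S\cup\{i\})-v(S)\bigr),\qquad i\in M,$$ lies in the core. -/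

import Mathlib

open MeasureTheory ProbabilityTheory

noncomputable section

/-! ### Cooperative games with transferable utility -/

/-- The core of the TU game with player set `A` and value function `v`. -/
def core {A : Type*} [Fintype A] (v : Finset A → ℝ) : Set (A → ℝ) :=
  {p | ∑ i, p i = v Finset.univ ∧ ∀ C : Finset A, v C ≤ ∑ i ∈ C, p i}

open Classical in
/-- The Shapley value of the TU game with player set `A` and value function `v`. -/
def shapleyValue {A : Type*} [Fintype A] (v : Finset A → ℝ) (i : A) : ℝ :=
  (1 / (Fintype.card A : ℝ)) *
    ∑ S ∈ (Finset.univ.erase i).powerset,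
      ((Nat.choose (Fintype.card A - 1) S.card : ℝ))⁻¹ * (v (insert i S) - v S)

/-! ### Linear bandit instances with a fixed action set -/

/-- A linear bandit instance in which every agent has the same finite action set at every time.
The reward of an action `x` is `⟪θ, x⟫` plus a noise term of law `noise`; the noise terms of all
agents and times are independent. -/
structure FixedInstance (d : ℕ) where
  /-- the unknown model parameter -/
  θ : EuclideanSpace ℝ (Fin d)
  /-- the common action set -/
  X : Finset (EuclideanSpace ℝ (Fin d))
  X_nonempty : X.Nonempty
  /-- the common law of the noise terms -/
  noise : Measure ℝ
  isProbabilityMeasure_noise : IsProbabilityMeasure noise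
  noise_mean_zero : ∫ η, η ∂noise = 0
  noise_subgaussian : ∃ σ2 : NNReal, HasSubgaussianMGF id σ2 noise

namespace FixedInstance

variable {d : ℕ} (I : FixedInstance d)

instance : IsProbabilityMeasure I.noise := I.isProbabilityMeasure_noise

/-- The expected reward of an action. -/
def meanReward (x : EuclideanSpace ℝ (Fin d)) : ℝ := inner ℝ I.θ x

/-- The expected reward of an optimal action. -/
def optReward : ℝ := I.X.sup' I.X_nonempty I.meanReward

/-- The largest sub-optimality gap of an action. -/
def maxGap : ℝ := I.X.sup' I.X_nonempty fun x => I.optReward - I.meanReward x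

end FixedInstance

/-! ### Single-agent algorithms -/

/-- A (possibly randomized) single-agent bandit algorithm for the finite action set `X`. Its
internal randomness is a random seed, drawn before play starts and independent of the rewards; the
next action is a function of the seed and of the history of actions and rewards, listed in
chronological order. -/
structure SingleAgentAlgorithm {d : ℕ} (X : Finset (EuclideanSpace ℝ (Fin d))) where
  Seed : Type*
  measurableSpaceSeed : MeasurableSpace Seed
  seedLaw : Measure Seed
  isProbabilityMeasure_seedLaw : IsProbabilityMeasure seedLaw
  act : Seed → List (X × ℝ) → X
  measurable_act : ∀ n : ℕ,
    Measurable fun p : Seed × (Fin n → X × ℝ) => act p.1 (List.ofFn p.2)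

namespace SingleAgentAlgorithm

variable {d : ℕ} {X : Finset (EuclideanSpace ℝ (Fin d))} (Sin : SingleAgentAlgorithm X)

instance : MeasurableSpace Sin.Seed := Sin.measurableSpaceSeed

instance : IsProbabilityMeasure Sin.seedLaw := Sin.isProbabilityMeasure_seedLaw

end SingleAgentAlgorithm

/-- The history of the first `t` steps of a run of the single-agent algorithm `Sin` on the
instance `I`, for a given seed `ω` and given noise terms `η`. -/
def singleHistory {d : ℕ} (I : FixedInstance d) (Sin : SingleAgentAlgorithm I.X)
    (ω : Sin.Seed) (η : ℕ → ℝ) : ℕ → List (I.X × ℝ)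
  | 0 => []
  | t + 1 =>
    let h := singleHistory I Sin ω η t
    let x := Sin.act ω h
    h ++ [(x, I.meanReward x + η t)]

/-- The expected (pseudo-)regret of the single-agent algorithm `Sin` over `T` steps. -/
def singleRegret {d : ℕ} (I : FixedInstance d) (Sin : SingleAgentAlgorithm I.X) (T : ℕ) : ℝ :=
  ∑ t ∈ Finset.range T,
    (I.optReward - ∫ p : Sin.Seed × (ℕ → ℝ),
      I.meanReward (Sin.act p.1 (singleHistory I Sin p.1 p.2 t))
        ∂(Sin.seedLaw.prod (Measure.infinitePi fun _ : ℕ => I.noise)))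

/-! ### Multi-agent algorithms, regret and the collaboration game -/

/-- A (possibly randomized) multi-agent algorithm for the agents `A` and the finite action set `X`.
For every coalition `C`, the profile of actions to be played next by the agents in `C` is a function
of the seed and of the coalition history, that is, the chronological list of the actions played and
the rewards observed by all agents in `C`. -/
structure MultiAgentAlgorithm {d : ℕ} (A : Type*) (X : Finset (EuclideanSpace ℝ (Fin d))) where
  Seed : Type*
  measurableSpaceSeed : MeasurableSpace Seed
  seedLaw : Measure Seed
  isProbabilityMeasure_seedLaw : IsProbabilityMeasure seedLaw
  act : (C : Finset A) → Seed → List (C → X × ℝ) → C → X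

namespace MultiAgentAlgorithm

variable {d : ℕ} {A : Type*} {X : Finset (EuclideanSpace ℝ (Fin d))} (Alg : MultiAgentAlgorithm A X)

instance : MeasurableSpace Alg.Seed := Alg.measurableSpaceSeed

instance : IsProbabilityMeasure Alg.seedLaw := Alg.isProbabilityMeasure_seedLaw

end MultiAgentAlgorithm

/-- The history of the coalition `C` after `t` time-steps of a run of `Alg` on the instance `I`,
for a given seed `ω` and given noise terms `η (a, s)` of agent `a` at time `s`. -/
def coalitionHistory {d : ℕ} {A : Type*} (I : FixedInstance d) (Alg : MultiAgentAlgorithm A I.X)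
    (C : Finset A) (ω : Alg.Seed) (η : A × ℕ → ℝ) : ℕ → List (C → I.X × ℝ)
  | 0 => []
  | t + 1 =>
    let H := coalitionHistory I Alg C ω η t
    let x := Alg.act C ω H
    H ++ [fun a => (x a, I.meanReward (x a) + η (a, t))]

/-- The expected (pseudo-)regret of agent `a` of the coalition `C` over `T` time-steps. -/
def regret {d : ℕ} {A : Type*} (I : FixedInstance d) (Alg : MultiAgentAlgorithm A I.X)
    (C : Finset A) (a : C) (T : ℕ) : ℝ :=
  ∑ t ∈ Finset.range T,
    (I.optReward - ∫ p : Alg.Seed × (A × ℕ → ℝ),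
      I.meanReward (Alg.act C p.1 (coalitionHistory I Alg C p.1 p.2 t) a)
        ∂(Alg.seedLaw.prod (Measure.infinitePi fun _ : A × ℕ => I.noise)))

/-- The value function of the collaboration game: minus the total regret of a coalition. -/
def collaborationValue {d : ℕ} {A : Type*} (I : FixedInstance d) (Alg : MultiAgentAlgorithm A I.X)
    (T : ℕ) (C : Finset A) : ℝ :=
  -∑ a : C, regret I Alg C a T

/-! ### The meta-algorithm -/

/-- The rule by which the meta-algorithm removes a reward from a non-empty buffer: when coalition
`C` reads at the given step from the buffer of the given action, and `s` is the set of the agents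
whose rewards are still in that buffer, it names the agent whose reward is removed. The choice is
arbitrary, but made without looking at the rewards. -/
abbrev RemovalRule {d : ℕ} (A : Type*) (X : Finset (EuclideanSpace ℝ (Fin d))) :=
  (C : Finset A) → ℕ → X → (s : Finset C) → s.Nonempty → {a : C // a ∈ s}

/-- The internal state of the meta-algorithm. The buffer of the action `x` consists of the rewards
`reward x a` for `a ∈ avail x`. -/
structure MulState {d : ℕ} {A : Type*} (X : Finset (EuclideanSpace ℝ (Fin d))) (C : Finset A) where
  avail : X → Finset C
  reward : X → C → ℝ
  /-- the history of the simulated single-agent play -/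
  hist : List (X × ℝ)
  /-- the next action of the simulated single-agent play -/
  cur : X

section Mul

variable {d : ℕ} {A : Type*} {X : Finset (EuclideanSpace ℝ (Fin d))}

/-- Empty buffers, empty simulated history, and the first action of `Sin`. -/
def mulInit (Sin : SingleAgentAlgorithm X) (C : Finset A) (ω : Sin.Seed) : MulState X C where
  avail := fun _ => ∅
  reward := fun _ _ => 0
  hist := []
  cur := Sin.act ω []

open Classical in
/-- Replace the content of the buffer of the current action by the new rewards of all agents. -/
def mulReplenish {C : Finset A} (s : MulState X C) (y : C → ℝ) : MulState X C :=
  { s with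
    avail := Function.update s.avail s.cur Finset.univ
    reward := Function.update s.reward s.cur y }

open Classical in
/-- One pass of the inner loop: if the buffer of the current action is non-empty, remove a reward
from it, append it to the simulated history, and get the next action from `Sin`; otherwise do
nothing. -/
def mulRead (Sin : SingleAgentAlgorithm X) (ρ : RemovalRule A X) {C : Finset A} (ω : Sin.Seed)
    (s : MulState X C) : MulState X C :=
  if hs : (s.avail s.cur).Nonempty then
    let a : C := (ρ C s.hist.length s.cur (s.avail s.cur) hs).1
    let h := s.hist ++ [(s.cur, s.reward s.cur a)]
    { avail := Function.update s.avail s.cur ((s.avail s.cur).erase a)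
      reward := s.reward
      hist := h
      cur := Sin.act ω h }
  else s

/-- The total number of rewards in the buffers. -/
def mulBufferSize {C : Finset A} (s : MulState X C) : ℕ := ∑ x, (s.avail x).card

/-- The inner loop: read until the buffer of the current action is empty. Every reading removes a
reward, so that the loop ends after at most `mulBufferSize s` readings. -/
def mulDrain (Sin : SingleAgentAlgorithm X) (ρ : RemovalRule A X) {C : Finset A} (ω : Sin.Seed)
    (s : MulState X C) : MulState X C :=
  (mulRead Sin ρ ω)^[mulBufferSize s] s

theorem mulRead_of_nonempty (Sin : SingleAgentAlgorithm X) (ρ : RemovalRule A X) {C : Finset A}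
    (ω : Sin.Seed) (s : MulState X C) (hs : (s.avail s.cur).Nonempty) :
    mulBufferSize (mulRead Sin ρ ω s) + 1 = mulBufferSize s := by
  classical
  have hmem := (ρ C s.hist.length s.cur (s.avail s.cur) hs).2
  have hcard := Finset.card_erase_add_one hmem
  simp only [mulBufferSize, mulRead, hs, dif_pos]
  rw [← Finset.add_sum_erase _ _ (Finset.mem_univ s.cur),
    ← Finset.add_sum_erase _ (fun x => (s.avail x).card) (Finset.mem_univ s.cur)]
  have hrest : ∀ x ∈ Finset.univ.erase s.cur,
      ((Function.update s.avail s.cur ((s.avail s.cur).erase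
        (ρ C s.hist.length s.cur (s.avail s.cur) hs).1)) x).card = (s.avail x).card := by
    intro x hx
    rw [Function.update_of_ne (Finset.ne_of_mem_erase hx)]
  rw [Finset.sum_congr rfl hrest, Function.update_self, ← hcard]
  convert Nat.add_right_comm _ _ _ using 3

/-- The inner loop does end with an empty buffer of the current action. -/
theorem mulDrain_avail_cur (Sin : SingleAgentAlgorithm X) (ρ : RemovalRule A X) {C : Finset A}
    (ω : Sin.Seed) (s : MulState X C) :
    (mulDrain Sin ρ ω s).avail (mulDrain Sin ρ ω s).cur = ∅ := by
  suffices H : ∀ n (s : MulState X C), mulBufferSize s = n →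
      ((mulRead Sin ρ ω)^[n] s).avail ((mulRead Sin ρ ω)^[n] s).cur = ∅ from H _ s rfl
  intro n
  induction n with
  | zero =>
    intro s hs
    have h := (Finset.sum_eq_zero_iff.mp hs) s.cur (Finset.mem_univ _)
    exact Finset.card_eq_zero.mp h
  | succ n ih =>
    intro s hs
    rw [Function.iterate_succ_apply]
    by_cases hne : (s.avail s.cur).Nonempty
    · exact ih _ (by have := mulRead_of_nonempty Sin ρ ω s hne; omega)
    · have hfix : mulRead Sin ρ ω s = s := by simp [mulRead, hne]
      rw [hfix, Function.iterate_fixed hfix]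
      exact Finset.not_nonempty_iff_eq_empty.mp hne

/-- The state of the meta-algorithm after it has processed a coalition history. -/
def mulState (Sin : SingleAgentAlgorithm X) (ρ : RemovalRule A X) (C : Finset A) (ω : Sin.Seed)
    (H : List (C → X × ℝ)) : MulState X C :=
  H.foldl (fun s r => mulDrain Sin ρ ω (mulReplenish s fun a => (r a).2)) (mulInit Sin C ω)

/-- The multi-agent meta-algorithm built on the single-agent algorithm `Sin`: every agent of the
coalition plays the current action of the simulated single-agent play. -/
def mulAlgorithm (Sin : SingleAgentAlgorithm X) (ρ : RemovalRule A X) : MultiAgentAlgorithm A X where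
  Seed := Sin.Seed
  measurableSpaceSeed := Sin.measurableSpaceSeed
  seedLaw := Sin.seedLaw
  isProbabilityMeasure_seedLaw := Sin.isProbabilityMeasure_seedLaw
  act := fun C ω H _ => (mulState Sin ρ C ω H).cur

end Mul

/-! ### The assumption on the regret of the single-agent algorithm -/

/-- The discrete first derivative `R'(t, h)`. -/
def discreteDeriv (R : ℕ → ℝ) (t h : ℕ) : ℝ := (R (t + h) - R t) / h

/-- The discrete second derivative `R''(t, g, h)`. -/
def discreteDeriv₂ (R : ℕ → ℝ) (t g h : ℕ) : ℝ :=
  (discreteDeriv R (t + g) h - discreteDeriv R t h) / g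

/-- The assumption on the regret curve `R`, up to time `N`: strict concavity, quantified by the
positive numbers `υ t`, and the logarithmic limitation with constants `c` and `ε`. -/
structure RegretRate (R : ℕ → ℝ) (N : ℕ) (υ : ℕ → ℝ) (c ε : ℝ) : Prop where
  υ_pos : ∀ t : ℕ, t + 2 ≤ N → 0 < υ t
  ε_pos : 0 < ε
  strict_concavity : ∀ t g h : ℕ, 0 < g → 0 < h → t + g + h ≤ N →
    discreteDeriv₂ R t g h ≤ -υ t
  logarithmic_limitation : ∀ t g h : ℕ, 0 < t → 0 < g → 0 < h → t + g + h ≤ N →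
    -c * (t : ℝ) ^ (-2 + ε) ≤ discreteDeriv₂ R t g h

end

/-! The game is convex, and the Shapley value of a convex game lies in the core
(`shapleyValue_mem_core`). For the latter, compare `v` with the game `S ↦ v (S ∩ C)`. There, players
outside `C` are null players, so the Shapley shares of `C` add up to `v C`; by convexity, each of
these shares is at most the corresponding share in `v`.

Convexity follows from an estimate of each coalition value: `v C` equals `-R(|C| T)` up to an error
of `|C| K Δ` (`abs_collaborationValue_add_singleRegret_le`). With `t = |S| T`, strict concavity
makes the second difference `R(t + 2T) - 2 R(t + T) + R(t)` at most `-υ_t T²`. The four error terms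
total `4 (|S| + 1) K Δ ≤ 4 M K Δ`, and the lower bound on `T` ensures that `υ_t T²` absorbs them.

The estimate of `v C` has two ingredients. The first is distributional: the simulated play of `Sin`
has the law of a genuine run (`measurePreserving_simNoise`). Rewards leave the buffers out of
chronological order, at random positions, but the position read next depends only on the seed and on
values read before, and no position is read twice. Values read from an i.i.d. array in this way are
again i.i.d. (`map_selected_infinitePi`). The query rule is made explicit by tracking buffers
without reward values (`bufferState`, `rewardSource`); this bookkeeping is defined for infinitely
many steps, so the simulated play continues beyond horizon `T`.

The second ingredient holds along every run (`abs_sum_gap_sub_le`): each play enters the simulated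
history or is still buffered, and at most `|C| K` rewards are buffered. -/

noncomputable section

/-! ### Convex games -/

/-- The Shapley value distributes the value of the grand coalition, up to that of the empty one. -/
theorem sum_shapleyValue {A : Type*} [Fintype A] [Nonempty A] (v : Finset A → ℝ) :
    ∑ i, shapleyValue v i = v Finset.univ - v ∅ := by
  classical
  set M := Fintype.card A with hM
  have hMpos : 0 < M := Fintype.card_pos
  -- The weight of a marginal contribution to a coalition of size `k`. The plan is to collect the
  -- total coefficient of each `v S` after summing over all players.
  let g : ℕ → ℝ := fun k => 1 / (M : ℝ) * ((M - 1).choose k : ℝ)⁻¹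
  have h1 : ∀ i : A, shapleyValue v i =
      ∑ S : Finset A, (if i ∈ S then g (S.card - 1) * v S else 0)
        - ∑ S : Finset A, (if i ∉ S then g S.card * v S else 0) := by
    intro i
    have hp : (Finset.univ.erase i).powerset = Finset.univ.filter fun S : Finset A => i ∉ S := by
      ext S
      simp only [Finset.mem_powerset, Finset.mem_filter, Finset.mem_univ, true_and,
        Finset.subset_erase, Finset.subset_univ]
    have hb : ∑ S : Finset A with i ∉ S, g S.card * v (insert i S)
        = ∑ S : Finset A with i ∈ S, g (S.card - 1) * v S := by
      refine Finset.sum_bij' (fun S _ => insert i S) (fun S _ => S.erase i) ?_ ?_ ?_ ?_ ?_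
      · intro S hS; simp
      · intro S hS; simp
      · intro S hS; exact Finset.erase_insert (by simpa using hS)
      · intro S hS; exact Finset.insert_erase (by simpa using hS)
      · intro S hS
        rw [Finset.card_insert_of_notMem (by simpa using hS), Nat.add_sub_cancel]
    rw [← Finset.sum_filter, ← Finset.sum_filter, ← hb, ← Finset.sum_sub_distrib, shapleyValue,
      Finset.mul_sum]
    refine Finset.sum_congr (by convert hp) fun S _ => ?_
    simp only [g]
    have e : (insert i S : Finset A) = @insert A (Finset A)
        (@Finset.instInsert A fun a b => Classical.propDecidable (a = b)) i S := by congr!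
    rw [e]
    ring
  -- The `|S|` members contribute the positive terms, and `k * g (k - 1) = 1 / choose M k`.
  have h2 : ∀ S : Finset A, ∑ i : A, (if i ∈ S then g (S.card - 1) * v S else 0)
      = if S = ∅ then 0 else (M.choose S.card : ℝ)⁻¹ * v S := by
    intro S
    rw [← Finset.sum_filter, Finset.sum_const, Finset.filter_mem_eq_inter, Finset.univ_inter]
    split_ifs with h
    · simp [h]
    · have hc : 0 < S.card := Finset.card_pos.mpr (Finset.nonempty_iff_ne_empty.mpr h)
      have hle : S.card ≤ M := Finset.card_le_univ S
      obtain ⟨k, hk⟩ : ∃ k, S.card = k + 1 := ⟨S.card - 1, by omega⟩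
      obtain ⟨m, hm⟩ : ∃ m, M = m + 1 := ⟨M - 1, by omega⟩
      have hid := Nat.add_one_mul_choose_eq m k
      have hid' : ((m : ℝ) + 1) * m.choose k = (m + 1).choose (k + 1) * (k + 1) := by
        exact_mod_cast hid
      have p1 : (m.choose k : ℝ) ≠ 0 := by
        exact_mod_cast (Nat.choose_pos (by omega)).ne'
      have p2 : ((m + 1).choose (k + 1) : ℝ) ≠ 0 := by
        exact_mod_cast (Nat.choose_pos (by omega)).ne'
      have p3 : ((m : ℝ) + 1) ≠ 0 := by positivity
      simp only [g, hk, hm, Nat.add_sub_cancel, nsmul_eq_mul]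
      push_cast
      field_simp
      linear_combination (-v S) * hid'
  -- The `M - |S|` outsiders contribute the negative terms, and `(M - k) * g k = 1 / choose M k` for
  -- `k < M`. This matches the positive coefficient, so only `∅` and the grand coalition survive.
  have h3 : ∀ S : Finset A, ∑ i : A, (if i ∉ S then g S.card * v S else 0)
      = if S = Finset.univ then 0 else (M.choose S.card : ℝ)⁻¹ * v S := by
    intro S
    rw [← Finset.sum_filter, Finset.sum_const, Finset.filter_notMem_eq_sdiff,
      Finset.card_sdiff_of_subset (Finset.subset_univ _), Finset.card_univ, ← hM]
    split_ifs with h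
    · simp [h, ← hM]
    · have hlt : S.card < M := (Finset.card_lt_iff_ne_univ S).mpr h
      obtain ⟨m, hm⟩ : ∃ m, M = m + 1 := ⟨M - 1, by omega⟩
      have hid := Nat.choose_mul_succ_eq m S.card
      have p1 : (m.choose S.card : ℝ) ≠ 0 := by
        exact_mod_cast (Nat.choose_pos (by omega)).ne'
      have p2 : ((m + 1).choose S.card : ℝ) ≠ 0 := by
        exact_mod_cast (Nat.choose_pos (by omega)).ne'
      have p3 : ((m : ℝ) + 1) ≠ 0 := by positivity
      have hid' : (m.choose S.card : ℝ) * (m + 1)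
          = (m + 1).choose S.card * ((m + 1 - S.card : ℕ) : ℝ) := by
        exact_mod_cast hid
      simp only [g, hm, Nat.add_sub_cancel, nsmul_eq_mul]
      push_cast
      field_simp
      linear_combination (-v S) * hid'
  simp only [h1]
  rw [Finset.sum_sub_distrib, Finset.sum_comm, Finset.sum_comm (γ := A)]
  simp only [h2, h3]
  rw [← Finset.sum_sub_distrib]
  have h4 : ∀ S : Finset A, ((if S = ∅ then 0 else (M.choose S.card : ℝ)⁻¹ * v S)
      - if S = Finset.univ then 0 else (M.choose S.card : ℝ)⁻¹ * v S)
      = (if S = Finset.univ then v S else 0) - (if S = ∅ then v S else 0) := by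
    intro S
    have hne : (Finset.univ : Finset A) ≠ ∅ := Finset.univ_nonempty.ne_empty
    by_cases ha : S = ∅
    · subst ha; simp [hne.symm]
    · by_cases hb : S = Finset.univ
      · subst hb; simp [ha, ← hM]
      · simp [ha, hb]
  simp only [h4, Finset.sum_sub_distrib, Finset.sum_ite_eq', Finset.mem_univ, if_true]

open Classical in
/-- In a convex game, marginal contributions increase with the coalition. -/
theorem marginal_le_marginal_union {A : Type*} {v : Finset A → ℝ}
    (hv : ∀ (S : Finset A) (i j : A), i ∉ S → j ∉ S → i ≠ j →
      v (insert i S) + v (insert j S) ≤ v (insert i (insert j S)) + v S)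
    (S D : Finset A) {i : A} (hS : i ∉ S) (hD : i ∉ D) :
    v (insert i S) - v S ≤ v (insert i (D ∪ S)) - v (D ∪ S) := by
  induction D using Finset.induction_on with
  | empty => simp
  | insert j D hj ih =>
    have hij : i ≠ j := fun e => hD (e ▸ Finset.mem_insert_self _ _)
    have hiD : i ∉ D := fun e => hD (Finset.mem_insert_of_mem e)
    specialize ih hiD
    rw [Finset.insert_union]
    by_cases hm : j ∈ D ∪ S
    · rwa [Finset.insert_eq_self.mpr hm]
    · have := hv (D ∪ S) i j (by simp [hiD, hS]) hm hij
      linarith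

open Classical in
/-- The Shapley value of a convex game lies in the core. -/
theorem shapleyValue_mem_core {A : Type*} [Fintype A] {v : Finset A → ℝ} (h0 : v ∅ = 0)
    (hv : ∀ (S : Finset A) (i j : A), i ∉ S → j ∉ S → i ≠ j →
      v (insert i S) + v (insert j S) ≤ v (insert i (insert j S)) + v S) :
    shapleyValue v ∈ core v := by
  rcases isEmpty_or_nonempty A with hA | hA
  · refine ⟨?_, fun C => ?_⟩
    · simp [Finset.univ_eq_empty, h0]
    · simp [Finset.eq_empty_of_isEmpty C, h0]
  refine ⟨by rw [sum_shapleyValue, h0, sub_zero], fun C => ?_⟩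
  set w : Finset A → ℝ := fun S => v (S ∩ C) with hw
  have hout : ∀ i ∉ C, shapleyValue w i = 0 := by
    intro i hi
    rw [shapleyValue, Finset.sum_eq_zero, mul_zero]
    intro S _
    simp only [hw]
    rw [Finset.insert_inter_of_notMem hi, sub_self, mul_zero]
  have hin : ∀ i ∈ C, shapleyValue w i ≤ shapleyValue v i := by
    intro i hi
    refine mul_le_mul_of_nonneg_left (Finset.sum_le_sum fun S hS => ?_) (by positivity)
    refine mul_le_mul_of_nonneg_left ?_ (by positivity)
    have hiS : i ∉ S := fun h => by
      have := Finset.mem_powerset.mp hS h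
      simp at this
    have := marginal_le_marginal_union hv (S ∩ C) S (fun h => hiS (Finset.mem_inter.mp h).1) hiS
    rw [Finset.union_eq_left.mpr Finset.inter_subset_left] at this
    simp only [hw]
    rw [Finset.insert_inter_of_mem hi]
    exact this
  calc v C = w Finset.univ - w ∅ := by simp [hw, h0]
    _ = ∑ i, shapleyValue w i := (sum_shapleyValue w).symm
    _ = ∑ i ∈ C, shapleyValue w i :=
        (Finset.sum_subset (Finset.subset_univ C) fun i _ hi => hout i hi).symm
    _ ≤ ∑ i ∈ C, shapleyValue v i := Finset.sum_le_sum hin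

/-! ### Sequential selection from independent variables -/

section Selection

variable {ι : Type*} (μ : Measure ℝ) [IsProbabilityMeasure μ]

open Classical in
theorem measurable_update_coordinate (p : ι) :
    Measurable fun u : (ι → ℝ) × ℝ => Function.update u.1 p u.2 := by
  refine measurable_pi_lambda _ fun i => ?_
  by_cases hi : i = p
  · subst hi; simpa using measurable_snd
  · simp only [Function.update_of_ne hi]
    exact (measurable_pi_apply i).comp measurable_fst

open Classical in
/-- Resampling one coordinate preserves the product measure. -/
theorem map_update_infinitePi (p : ι) :
    ((Measure.infinitePi fun _ : ι => μ).prod μ).map (fun u => Function.update u.1 p u.2)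
      = Measure.infinitePi fun _ : ι => μ := by
  have hmeas := measurable_update_coordinate p
  refine Measure.eq_infinitePi _ fun s t ht => ?_
  rw [Measure.map_apply hmeas (MeasurableSet.pi s.countable_toSet fun i _ => ht i)]
  by_cases hp : p ∈ s
  · have : (fun u : (ι → ℝ) × ℝ => Function.update u.1 p u.2) ⁻¹' (s : Set ι).pi t
        = ((s.erase p : Finset ι) : Set ι).pi t ×ˢ t p := by
      ext u
      simp only [Set.mem_preimage, Set.mem_pi, Set.mem_prod, Finset.mem_coe]
      constructor
      · intro h
        refine ⟨fun i hi => ?_, by simpa using h p hp⟩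
        have := h i (Finset.mem_of_mem_erase hi)
        rwa [Function.update_of_ne (Finset.ne_of_mem_erase hi)] at this
      · rintro ⟨h1, h2⟩ i hi
        by_cases hip : i = p
        · subst hip; simpa using h2
        · rw [Function.update_of_ne hip]; exact h1 i (Finset.mem_erase.mpr ⟨hip, hi⟩)
    rw [this, Measure.prod_prod, Measure.infinitePi_pi _ fun i _ => ht i,
      Finset.prod_erase_mul s (fun i => μ (t i)) hp]
  · have : (fun u : (ι → ℝ) × ℝ => Function.update u.1 p u.2) ⁻¹' (s : Set ι).pi t
        = (s : Set ι).pi t ×ˢ Set.univ := by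
      ext u
      simp only [Set.mem_preimage, Set.mem_pi, Set.mem_prod, Finset.mem_coe, Set.mem_univ, and_true]
      refine forall₂_congr fun i hi => ?_
      rw [Function.update_of_ne (fun e : i = p => hp (e ▸ hi))]
    rw [this, Measure.prod_prod, Measure.infinitePi_pi _ fun i _ => ht i, measure_univ, mul_one]

open Classical in
/-- An event that does not depend on the coordinate `p` is independent of that coordinate. -/
theorem infinitePi_inter_coordinate (p : ι) {E : Set (ι → ℝ)} (hE : MeasurableSet E)
    (hinv : ∀ η z, Function.update η p z ∈ E ↔ η ∈ E) {D : Set ℝ} (hD : MeasurableSet D) :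
    (Measure.infinitePi fun _ : ι => μ) (E ∩ {η | η p ∈ D})
      = (Measure.infinitePi fun _ : ι => μ) E * μ D := by
  have hmeas := measurable_update_coordinate p
  -- Resample the coordinate `p`. By `hinv` the event `E` does not notice, so the preimage is the
  -- rectangle `E ×ˢ D`.
  conv_lhs => rw [← map_update_infinitePi μ p]
  have hc : MeasurableSet {η : ι → ℝ | η p ∈ D} := measurable_pi_apply p hD
  rw [Measure.map_apply hmeas (hE.inter hc), ← Measure.prod_prod]
  congr 1
  ext u
  simp [hinv]

/-- The first values of the sequence that reads, at step `s`, the coordinate of `η` that the query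
rule `q` names on the basis of the values read before. -/
def selectPrefix (q : ℕ → (ℕ → ℝ) → ι) (η : ι → ℝ) : ℕ → ℕ → ℝ
  | 0 => 0
  | s + 1 => Function.update (selectPrefix q η s) s (η (q s (selectPrefix q η s)))

/-- The sequence of all values read by the query rule `q`. -/
def selected (q : ℕ → (ℕ → ℝ) → ι) (η : ι → ℝ) (s : ℕ) : ℝ := η (q s (selectPrefix q η s))

theorem selectPrefix_of_lt (q : ℕ → (ℕ → ℝ) → ι) (η : ι → ℝ) {s r : ℕ} (h : r < s) :
    selectPrefix q η s r = selected q η r := by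
  induction s with
  | zero => omega
  | succ s ih =>
    rw [selectPrefix]
    by_cases hr : r = s
    · subst hr; simp [selected]
    · rw [Function.update_of_ne hr]; exact ih (by omega)

/-- A query rule is causal if its `s`-th query depends only on the values read before step `s`. -/
def IsCausal (q : ℕ → (ℕ → ℝ) → ι) : Prop :=
  ∀ s (ξ ξ' : ℕ → ℝ), (∀ r < s, ξ r = ξ' r) → q s ξ = q s ξ'

/-- Causality lets the finite prefix be replaced by the whole sequence. The recursion thus becomes a
fixed-point equation, in which all later arguments are carried out. -/
theorem selected_eq {q : ℕ → (ℕ → ℝ) → ι} (hq : IsCausal q) (η : ι → ℝ) (s : ℕ) :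
    selected q η s = η (q s (selected q η)) := by
  conv_lhs => rw [selected, hq s _ (selected q η) fun r hr => selectPrefix_of_lt q η hr]

theorem measurable_selected {Ω : Type*} [MeasurableSpace Ω] [Countable ι] [MeasurableSpace ι]
    [MeasurableSingletonClass ι] {q : Ω → ℕ → (ℕ → ℝ) → ι}
    (hq : ∀ s, Measurable fun u : Ω × (ℕ → ℝ) => q u.1 s u.2) :
    Measurable fun u : Ω × (ι → ℝ) => selected (q u.1) u.2 := by
  have heval : Measurable fun u : ι × (ι → ℝ) => u.2 u.1 :=
    measurable_from_prod_countable_right fun p => measurable_pi_apply p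
  have hpre : ∀ s, Measurable fun u : Ω × (ι → ℝ) => selectPrefix (q u.1) u.2 s := by
    intro s
    induction s with
    | zero => exact measurable_const
    | succ s ih =>
      refine measurable_pi_lambda _ fun r => ?_
      by_cases hr : r = s
      · subst hr
        simp only [selectPrefix, Function.update_self]
        exact heval.comp (((hq r).comp (measurable_fst.prodMk ih)).prodMk measurable_snd)
      · simp only [selectPrefix, Function.update_of_ne hr]
        exact (measurable_pi_apply r).comp ih
  refine measurable_pi_lambda _ fun s => ?_
  exact heval.comp (((hq s).comp (measurable_fst.prodMk (hpre s))).prodMk measurable_snd)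

/-- Changing a coordinate that is not read before step `n` does not change the first `n` values. -/
theorem selected_update [DecidableEq ι] {q : ℕ → (ℕ → ℝ) → ι} (hq : IsCausal q) (η : ι → ℝ) (p : ι)
    (z : ℝ) (n : ℕ) (hp : ∀ r < n, q r (selected q η) ≠ p) :
    ∀ r < n, selected q (Function.update η p z) r = selected q η r := by
  intro r
  induction r using Nat.strong_induction_on with
  | _ r ih =>
    intro hr
    rw [selected_eq hq, selected_eq hq η,
      hq r _ (selected q η) fun k hk => ih k hk (hk.trans hr),
      Function.update_of_ne (hp r hr)]

/-- If a causal query rule never reads the same coordinate twice, then the values that it reads from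
i.i.d. variables are i.i.d. with the same law. -/
theorem map_selected_infinitePi [Countable ι] [MeasurableSpace ι] [MeasurableSingletonClass ι]
    {q : ℕ → (ℕ → ℝ) → ι} (hmeas : ∀ s, Measurable (q s)) (hq : IsCausal q)
    (hinj : ∀ ξ r s, r < s → q r ξ ≠ q s ξ) :
    (Measure.infinitePi fun _ : ι => μ).map (selected q) = Measure.infinitePi fun _ : ℕ => μ := by
  classical
  set P := Measure.infinitePi fun _ : ι => μ with hP
  have hsel : Measurable (selected q) :=
    (measurable_selected (Ω := Unit) (q := fun _ => q) fun s => (hmeas s).comp measurable_snd).comp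
      (measurable_const (a := ()) |>.prodMk measurable_id)
  have hsel' : ∀ s, Measurable fun η => selected q η s := fun s => (measurable_pi_apply s).comp hsel
  have hbox : ∀ (t : ℕ → Set ℝ), (∀ i, MeasurableSet (t i)) → ∀ n,
      P {η | ∀ r < n, selected q η r ∈ t r} = ∏ r ∈ Finset.range n, μ (t r) := by
    intro t ht n
    have hmE : ∀ n, MeasurableSet {η : ι → ℝ | ∀ r < n, selected q η r ∈ t r} := by
      intro n
      have : {η : ι → ℝ | ∀ r < n, selected q η r ∈ t r}
          = ⋂ r ∈ Finset.range n, {η | selected q η r ∈ t r} := by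
        ext η; simp
      rw [this]
      exact Finset.measurableSet_biInter _ fun r _ => hsel' r (ht r)
    induction n with
    | zero => simp [hP]
    | succ n ih =>
      rw [Finset.prod_range_succ, ← ih]
      set E := {η : ι → ℝ | ∀ r < n, selected q η r ∈ t r}
      -- Split according to which coordinate is read at step `n`. On `F p` the coordinate `p` has
      -- not been read before, so membership in `F p` is insensitive to it and
      -- `infinitePi_inter_coordinate` applies piece by piece.
      set F : ι → Set (ι → ℝ) := fun p => E ∩ {η | q n (selected q η) = p}
      have hF : ∀ p, MeasurableSet (F p) := fun p =>
        (hmE n).inter (((hmeas n).comp hsel) (measurableSet_singleton p))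
      have hdisj : Pairwise (Function.onFun Disjoint F) := by
        intro p p' hpp
        rw [Function.onFun, Set.disjoint_left]
        rintro η ⟨-, h1⟩ ⟨-, h2⟩
        exact hpp (h1.symm.trans h2)
      have hE : E = ⋃ p, F p := by
        ext η; simp [F]
      have hEs : {η : ι → ℝ | ∀ r < n + 1, selected q η r ∈ t r}
          = ⋃ p, F p ∩ {η | η p ∈ t n} := by
        ext η
        simp only [Set.mem_ofPred_eq, Set.mem_iUnion, Set.mem_inter_iff, F, E,
          Nat.forall_lt_succ_right]
        rw [selected_eq hq η n]
        constructor
        · rintro ⟨h1, h2⟩; exact ⟨_, ⟨h1, rfl⟩, h2⟩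
        · rintro ⟨p, ⟨h1, rfl⟩, h2⟩; exact ⟨h1, h2⟩
      have hfwd : ∀ p η z, η ∈ F p → Function.update η p z ∈ F p := by
        rintro p η z ⟨h1, h2⟩
        have hu := selected_update hq η p z n fun r hr => by
          have h2' : q n (selected q η) = p := h2
          rw [← h2']; exact hinj _ _ _ hr
        refine ⟨fun r hr => ?_, ?_⟩
        · rw [hu r hr]; exact h1 r hr
        · exact (hq n _ _ hu).trans h2
      have hinv : ∀ p η z, Function.update η p z ∈ F p ↔ η ∈ F p := fun p η z =>
        ⟨fun h => by simpa using hfwd p _ (η p) h, hfwd p η z⟩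
      have hc : ∀ p, MeasurableSet {η : ι → ℝ | η p ∈ t n} := fun p =>
        measurable_pi_apply p (ht n)
      rw [hEs, hE, measure_iUnion (fun p p' h => (hdisj h).mono Set.inter_subset_left
          Set.inter_subset_left) fun p => (hF p).inter (hc p),
        measure_iUnion hdisj hF, ← ENNReal.tsum_mul_right]
      exact tsum_congr fun p => infinitePi_inter_coordinate μ p (hF p) (hinv p) (ht n)
  refine Measure.eq_infinitePi _ fun s t ht => ?_
  rw [Measure.map_apply hsel (MeasurableSet.pi s.countable_toSet fun i _ => ht i)]
  -- Pad the box with `Set.univ` to an initial segment of steps, the form treated by `hbox`.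
  obtain ⟨n, hn⟩ := s.exists_nat_subset_range
  have h1 := hbox (fun i => if i ∈ s then t i else Set.univ)
    (fun i => by split_ifs; exacts [ht i, MeasurableSet.univ]) n
  rw [← Finset.prod_subset hn (f := fun i => μ (if i ∈ s then t i else Set.univ))
    (fun i _ hi => by simp [hi])] at h1
  rw [Finset.prod_congr rfl fun i hi => show μ (t i) = μ (if i ∈ s then t i else Set.univ) by
    simp [hi], ← h1]
  congr 1
  ext η
  simp only [Set.mem_preimage, Set.mem_pi, Finset.mem_coe, Set.mem_ofPred_eq]
  constructor
  · intro h r _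
    split_ifs with hr
    exacts [h r hr, Set.mem_univ _]
  · intro h i hi
    simpa [hi] using h i (Finset.mem_range.mp (hn hi))

end Selection

/-! ### The buffers of the meta-algorithm as a function of the simulated actions -/

section Buffers

variable {d : ℕ} {A : Type*} {X : Finset (EuclideanSpace ℝ (Fin d))} {C : Finset A}

/-- The buffers of the meta-algorithm without the reward values: the agents whose rewards are still
in the buffer of an action, the time at which it was last filled, and the number of plays so far. -/
structure BufferState (X : Finset (EuclideanSpace ℝ (Fin d))) (C : Finset A) where
  avail : X → Finset C
  fill : X → ℕ
  time : ℕ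

open Classical in
/-- Play the action `x` and fill its buffer. -/
def BufferState.play (σ : BufferState X C) (x : X) : BufferState X C where
  avail := Function.update σ.avail x Finset.univ
  fill := Function.update σ.fill x σ.time
  time := σ.time + 1

open Classical in
/-- Play the action `x` if its buffer is empty. -/
def BufferState.ensure (σ : BufferState X C) (x : X) : BufferState X C :=
  if (σ.avail x).Nonempty then σ else σ.play x

theorem BufferState.ensure_of_nonempty {σ : BufferState X C} {x : X} (h : (σ.avail x).Nonempty) :
    σ.ensure x = σ := if_pos h

theorem BufferState.ensure_of_empty {σ : BufferState X C} {x : X} (h : σ.avail x = ∅) :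
    σ.ensure x = σ.play x := if_neg (by simp [h])

/-- The rewards in the buffers are distinct, and differ from those in the set `U`. -/
structure BufferState.Fresh (σ : BufferState X C) (U : Set (A × ℕ)) : Prop where
  fill_lt : ∀ y, (σ.avail y).Nonempty → σ.fill y < σ.time
  fill_ne : ∀ y y', y ≠ y' → (σ.avail y).Nonempty → (σ.avail y').Nonempty → σ.fill y ≠ σ.fill y'
  used_lt : ∀ u ∈ U, u.2 < σ.time
  used_ne : ∀ y, ∀ a ∈ σ.avail y, ((a : A), σ.fill y) ∉ U

/-- A refilled buffer is stamped with the current time, which is later than every earlier fill and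
every reward already used. -/
theorem BufferState.Fresh.ensure {σ : BufferState X C} {U : Set (A × ℕ)} (h : σ.Fresh U) (x : X) :
    (σ.ensure x).Fresh U := by
  by_cases hx : (σ.avail x).Nonempty
  · rwa [ensure_of_nonempty hx]
  rw [ensure_of_empty (Finset.not_nonempty_iff_eq_empty.mp hx)]
  constructor
  · intro y hy
    by_cases hyx : y = x
    · subst hyx; simp [play]
    · simp only [play, Function.update_of_ne hyx] at hy ⊢
      exact (h.fill_lt y hy).trans (Nat.lt_succ_self _)
  · intro y y' hne hy hy'
    by_cases hyx : y = x
    · subst hyx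
      simp only [play, Function.update_self, Function.update_of_ne hne.symm] at hy' ⊢
      exact (h.fill_lt y' hy').ne'
    · by_cases hyx' : y' = x
      · subst hyx'
        simp only [play, Function.update_self, Function.update_of_ne hne] at hy ⊢
        exact (h.fill_lt y hy).ne
      · simp only [play, Function.update_of_ne hyx, Function.update_of_ne hyx'] at hy hy' ⊢
        exact h.fill_ne y y' hne hy hy'
  · intro u hu
    exact (h.used_lt u hu).trans (Nat.lt_succ_self _)
  · intro y a ha hu
    by_cases hyx : y = x
    · subst hyx
      simpa [play] using h.used_lt _ hu
    · simp only [play, Function.update_of_ne hyx] at ha hu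
      exact h.used_ne y a ha hu

variable [Nonempty C]

theorem BufferState.ensure_avail_nonempty (σ : BufferState X C) (x : X) :
    ((σ.ensure x).avail x).Nonempty := by
  by_cases h : (σ.avail x).Nonempty
  · rwa [ensure_of_nonempty h]
  · rw [ensure_of_empty (Finset.not_nonempty_iff_eq_empty.mp h)]
    simpa [play] using ⟨_, (Classical.arbitrary C).2⟩

/-- The agent whose reward is read at step `s` of the simulated play, where `x` is played. -/
def readAgent (ρ : RemovalRule A X) (σ : BufferState X C) (s : ℕ) (x : X) : C :=
  (ρ C s x ((σ.ensure x).avail x) (σ.ensure_avail_nonempty x)).1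

theorem readAgent_mem (ρ : RemovalRule A X) (σ : BufferState X C) (s : ℕ) (x : X) :
    readAgent ρ σ s x ∈ (σ.ensure x).avail x :=
  (ρ C s x ((σ.ensure x).avail x) (σ.ensure_avail_nonempty x)).2

open Classical in
/-- The buffers after step `s` of the simulated play, where `x` is played. -/
def BufferState.read (ρ : RemovalRule A X) (σ : BufferState X C) (s : ℕ) (x : X) :
    BufferState X C :=
  { σ.ensure x with
    avail := Function.update (σ.ensure x).avail x
      (((σ.ensure x).avail x).erase (readAgent ρ σ s x)) }

/-- The buffers after `s` steps of the simulated play, if `x` is the sequence of its actions. -/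
def bufferState (C : Finset A) [Nonempty C] (ρ : RemovalRule A X) (x : ℕ → X) :
    ℕ → BufferState X C
  | 0 => ⟨fun _ => ∅, fun _ => 0, 0⟩
  | s + 1 => (bufferState C ρ x s).read ρ s (x s)

/-- The agent and the time from which the reward read at step `s` originates. -/
def rewardSource (C : Finset A) [Nonempty C] (ρ : RemovalRule A X) (x : ℕ → X) (s : ℕ) : A × ℕ :=
  ((readAgent ρ (bufferState C ρ x s) s (x s) : C),
    ((bufferState C ρ x s).ensure (x s)).fill (x s))

theorem bufferState_congr (ρ : RemovalRule A X) {x x' : ℕ → X} {s : ℕ} (h : ∀ r < s, x r = x' r) :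
    bufferState C ρ x s = bufferState C ρ x' s := by
  induction s with
  | zero => rfl
  | succ s ih => rw [bufferState, bufferState, ih fun r hr => h r (by omega), h s (by omega)]

theorem rewardSource_congr (ρ : RemovalRule A X) {x x' : ℕ → X} {s : ℕ}
    (h : ∀ r < s + 1, x r = x' r) : rewardSource C ρ x s = rewardSource C ρ x' s := by
  rw [rewardSource, rewardSource, bufferState_congr ρ fun r hr => h r (by omega), h s (by omega)]

-- The reward just read has left its own buffer, and it cannot sit in another one because non-empty
-- buffers have distinct fill times. It can therefore join the used set.
open Classical in
theorem BufferState.Fresh.read {σ : BufferState X C} {U : Set (A × ℕ)} (h : σ.Fresh U)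
    (ρ : RemovalRule A X) (s : ℕ) (x : X) :
    (σ.read ρ s x).Fresh (insert ((readAgent ρ σ s x : A), (σ.ensure x).fill x) U) := by
  have he := h.ensure x
  have hmem := readAgent_mem ρ σ s x
  have hsub : ∀ y, (σ.read ρ s x).avail y ⊆ (σ.ensure x).avail y := by
    intro y
    by_cases hyx : y = x
    · subst hyx
      simp only [BufferState.read, Function.update_self]
      exact Finset.erase_subset _ _
    · simp [BufferState.read, Function.update_of_ne hyx]
  constructor
  · exact fun y hy => he.fill_lt y (hy.mono (hsub y))
  · exact fun y y' hne hy hy' => he.fill_ne y y' hne (hy.mono (hsub y)) (hy'.mono (hsub y'))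
  · rintro u (rfl | hu)
    · exact he.fill_lt x ⟨_, hmem⟩
    · exact he.used_lt u hu
  · rintro y a ha (hu | hu)
    · have hfill : (σ.ensure x).fill y = (σ.ensure x).fill x := congrArg Prod.snd hu
      have hag : a = readAgent ρ σ s x := Subtype.ext (congrArg Prod.fst hu)
      by_cases hyx : y = x
      · subst hyx
        simp [BufferState.read, hag] at ha
      · exact he.fill_ne y x hyx ⟨a, hsub y ha⟩ ⟨_, hmem⟩ hfill
    · exact he.used_ne y a (hsub y ha) hu

theorem bufferState_fresh (ρ : RemovalRule A X) (x : ℕ → X) (s : ℕ) :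
    (bufferState C ρ x s).Fresh {u | ∃ r < s, rewardSource C ρ x r = u} := by
  induction s with
  | zero => constructor <;> simp [bufferState]
  | succ s ih =>
    have h := ih.read ρ s (x s)
    have e : {u | ∃ r < s + 1, rewardSource C ρ x r = u}
        = insert (rewardSource C ρ x s) {u | ∃ r < s, rewardSource C ρ x r = u} := by
      ext u
      simp only [Set.mem_ofPred_eq, Set.mem_insert_iff, Nat.exists_lt_succ_right]
      rw [or_comm, eq_comm]
    rw [e]
    exact h

/-- The reward read at step `s` is still available then, and freshness keeps available rewards apart
from those used earlier. This is the injectivity that the selection theorem needs. -/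
theorem rewardSource_ne (ρ : RemovalRule A X) (x : ℕ → X) {r s : ℕ} (h : r < s) :
    rewardSource C ρ x r ≠ rewardSource C ρ x s := fun e =>
  ((bufferState_fresh ρ x s).ensure (x s)).used_ne (x s) _ (readAgent_mem ρ _ s (x s)) ⟨r, h, e⟩

theorem bufferState_time_mono (ρ : RemovalRule A X) (x : ℕ → X) :
    Monotone fun s => (bufferState C ρ x s).time := by
  refine monotone_nat_of_le_succ fun s => ?_
  change _ ≤ ((bufferState C ρ x s).ensure (x s)).time
  by_cases h : ((bufferState C ρ x s).avail (x s)).Nonempty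
  · rw [BufferState.ensure_of_nonempty h]
  · rw [BufferState.ensure_of_empty (Finset.not_nonempty_iff_eq_empty.mp h)]
    exact Nat.le_succ _

/-- There is at most one step of the simulated play at which an empty buffer is met at time `t`. -/
theorem bufferState_step_unique (ρ : RemovalRule A X) (x : ℕ → X) {s s' : ℕ}
    (ht : (bufferState C ρ x s).time = (bufferState C ρ x s').time)
    (hs : (bufferState C ρ x s).avail (x s) = ∅) (hs' : (bufferState C ρ x s').avail (x s') = ∅) :
    s = s' := by
  have key : ∀ {s s' : ℕ}, (bufferState C ρ x s).time = (bufferState C ρ x s').time →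
      (bufferState C ρ x s).avail (x s) = ∅ → ¬ s < s' := by
    intro s s' ht hs hlt
    have h1 := bufferState_time_mono (C := C) ρ x hlt
    have h2 : (bufferState C ρ x (s + 1)).time = (bufferState C ρ x s).time + 1 := by
      change ((bufferState C ρ x s).ensure (x s)).time = _
      rw [BufferState.ensure_of_empty hs]
      rfl
    simp only [Nat.succ_eq_add_one] at h1
    omega
  have h1 := key ht hs
  have h2 := key ht.symm hs'
  omega

end Buffers

/-! ### The simulated play -/

section Simulation

variable {d : ℕ} {A : Type*} (I : FixedInstance d) (Sin : SingleAgentAlgorithm I.X)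

/-- The action of `Sin` at step `s`, for a given seed and given noise terms. -/
def simAction (ω : Sin.Seed) (ξ : ℕ → ℝ) (s : ℕ) : I.X := Sin.act ω (singleHistory I Sin ω ξ s)

theorem length_singleHistory (ω : Sin.Seed) (ξ : ℕ → ℝ) (s : ℕ) :
    (singleHistory I Sin ω ξ s).length = s := by
  induction s with
  | zero => rfl
  | succ s ih => simp [singleHistory, ih]

theorem singleHistory_congr (ω : Sin.Seed) {ξ ξ' : ℕ → ℝ} {s : ℕ} (h : ∀ r < s, ξ r = ξ' r) :
    singleHistory I Sin ω ξ s = singleHistory I Sin ω ξ' s := by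
  induction s with
  | zero => rfl
  | succ s ih => simp only [singleHistory, ih fun r hr => h r (by omega), h s (by omega)]

theorem sum_singleHistory (ω : Sin.Seed) (ξ : ℕ → ℝ) (f : I.X → ℝ) (s : ℕ) :
    ((singleHistory I Sin ω ξ s).map fun u => f u.1).sum
      = ∑ r ∈ Finset.range s, f (simAction I Sin ω ξ r) := by
  induction s with
  | zero => rfl
  | succ s ih =>
    rw [Finset.sum_range_succ, ← ih]
    simp [singleHistory, simAction]

/-- The agent and the time whose noise term enters step `s` of the simulated play. -/
def simQuery (ρ : RemovalRule A I.X) (C : Finset A) [Nonempty C] (ω : Sin.Seed) (s : ℕ)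
    (ξ : ℕ → ℝ) : A × ℕ :=
  rewardSource C ρ (simAction I Sin ω ξ) s

theorem isCausal_simQuery (ρ : RemovalRule A I.X) (C : Finset A) [Nonempty C] (ω : Sin.Seed) :
    IsCausal (simQuery I Sin ρ C ω) := by
  intro s ξ ξ' h
  refine rewardSource_congr ρ fun r hr => ?_
  rw [simAction, simAction, singleHistory_congr I Sin ω fun k hk => h k (by omega)]

/-- The noise terms of the simulated play, as a function of those of the agents. -/
def simNoise (ρ : RemovalRule A I.X) (C : Finset A) [Nonempty C] (ω : Sin.Seed) (η : A × ℕ → ℝ) :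
    ℕ → ℝ :=
  selected (simQuery I Sin ρ C ω) η

/-- The state of the meta-algorithm on coalition `C` after `t` time-steps. -/
def mulStateAt (ρ : RemovalRule A I.X) (C : Finset A) (ω : Sin.Seed) (η : A × ℕ → ℝ) (t : ℕ) :
    MulState I.X C :=
  mulState Sin ρ C ω (coalitionHistory I (mulAlgorithm Sin ρ) C ω η t)

theorem mulStateAt_succ (ρ : RemovalRule A I.X) (C : Finset A) (ω : Sin.Seed) (η : A × ℕ → ℝ)
    (t : ℕ) :
    mulStateAt I Sin ρ C ω η (t + 1) = mulDrain Sin ρ ω (mulReplenish (mulStateAt I Sin ρ C ω η t)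
      fun a => I.meanReward (mulStateAt I Sin ρ C ω η t).cur + η (a, t)) := by
  change mulState Sin ρ C ω (coalitionHistory I (mulAlgorithm Sin ρ) C ω η t ++ [_]) = _
  rw [mulState, List.foldl_append]
  rfl

theorem mulStateAt_avail_cur (ρ : RemovalRule A I.X) (C : Finset A) (ω : Sin.Seed)
    (η : A × ℕ → ℝ) (t : ℕ) :
    (mulStateAt I Sin ρ C ω η t).avail (mulStateAt I Sin ρ C ω η t).cur = ∅ := by
  cases t with
  | zero => rfl
  | succ t => rw [mulStateAt_succ]; exact mulDrain_avail_cur _ _ _ _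

section Matching

variable {I Sin} {ρ : RemovalRule A I.X} {C : Finset A} [Nonempty C] {ω : Sin.Seed}
  {η : A × ℕ → ℝ}

/-- The state `st` of the meta-algorithm is that after `s` steps of the simulated play, with
buffers as described by `σ`. -/
structure Matches (ρ : RemovalRule A I.X) (ω : Sin.Seed) (η : A × ℕ → ℝ) (st : MulState I.X C)
    (s : ℕ) (σ : BufferState I.X C) : Prop where
  hist : st.hist = singleHistory I Sin ω (simNoise I Sin ρ C ω η) s
  cur : st.cur = simAction I Sin ω (simNoise I Sin ρ C ω η) s
  avail : st.avail = σ.avail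
  reward : ∀ y, ∀ a ∈ σ.avail y, st.reward y a = I.meanReward y + η (a, σ.fill y)

local notation "acts" => simAction I Sin ω (simNoise I Sin ρ C ω η)

-- The reward removed carries the noise of its source, which by `selected_eq` is term `s` of the
-- simulated noise. The hypothesis uses `ensure` so as to cover both a buffer just refilled and one
-- that was non-empty already.
open Classical in
theorem Matches.read {st : MulState I.X C} {s : ℕ}
    (h : Matches ρ ω η st s ((bufferState C ρ acts s).ensure (acts s))) :
    Matches ρ ω η (mulRead Sin ρ ω st) (s + 1) (bufferState C ρ acts (s + 1)) := by
  obtain ⟨avail, reward, hist, cur⟩ := st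
  obtain ⟨rfl, rfl, rfl, hr⟩ := h
  simp only at hr
  have hne := (bufferState C ρ acts s).ensure_avail_nonempty (acts s)
  have hnoise : simNoise I Sin ρ C ω η s
      = η (readAgent ρ (bufferState C ρ acts s) s (acts s),
        ((bufferState C ρ acts s).ensure (acts s)).fill (acts s)) :=
    selected_eq (isCausal_simQuery I Sin ρ C ω) η s
  have hhist : singleHistory I Sin ω (simNoise I Sin ρ C ω η) s
      ++ [(acts s, reward (acts s) (readAgent ρ (bufferState C ρ acts s) s (acts s)))]
      = singleHistory I Sin ω (simNoise I Sin ρ C ω η) (s + 1) := by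
    rw [hr _ _ (readAgent_mem ρ _ s _), ← hnoise]
    rfl
  have heq : mulRead Sin ρ ω ⟨((bufferState C ρ acts s).ensure (acts s)).avail, reward,
      singleHistory I Sin ω (simNoise I Sin ρ C ω η) s, acts s⟩
      = ⟨(bufferState C ρ acts (s + 1)).avail, reward,
        singleHistory I Sin ω (simNoise I Sin ρ C ω η) (s + 1), acts (s + 1)⟩ := by
    simp only [mulRead, hne, dif_pos, length_singleHistory]
    change MulState.mk _ _ (singleHistory I Sin ω (simNoise I Sin ρ C ω η) s
      ++ [(acts s, reward (acts s) (readAgent ρ (bufferState C ρ acts s) s (acts s)))])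
      (Sin.act ω (singleHistory I Sin ω (simNoise I Sin ρ C ω η) s
      ++ [(acts s, reward (acts s) (readAgent ρ (bufferState C ρ acts s) s (acts s)))])) = _
    rw [hhist]
    rfl
  rw [heq]
  refine ⟨rfl, rfl, rfl, fun y a ha => ?_⟩
  refine hr y a ?_
  by_cases hy : y = acts s
  · subst hy
    simp only [bufferState, BufferState.read, Function.update_self] at ha
    exact Finset.mem_of_mem_erase ha
  · simpa only [bufferState, BufferState.read, Function.update_of_ne hy] using ha

/-- Passes that meet an empty buffer are idle, so the step reached is only asserted to exist.
Reading from a non-empty buffer involves no play, hence the time stands still. -/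
theorem Matches.iterate_read {st : MulState I.X C} {s : ℕ}
    (h : Matches ρ ω η st s (bufferState C ρ acts s)) (k : ℕ) :
    ∃ s', Matches ρ ω η ((mulRead Sin ρ ω)^[k] st) s' (bufferState C ρ acts s') ∧
      (bufferState C ρ acts s').time = (bufferState C ρ acts s).time := by
  induction k generalizing st s with
  | zero => exact ⟨s, h, rfl⟩
  | succ k ih =>
    rw [Function.iterate_succ_apply]
    by_cases hne : (st.avail st.cur).Nonempty
    · have hne' : ((bufferState C ρ acts s).avail (acts s)).Nonempty := by
        rwa [h.avail, h.cur] at hne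
      have he := BufferState.ensure_of_nonempty hne'
      obtain ⟨s', h1, h2⟩ := ih (Matches.read (he.symm ▸ h))
      refine ⟨s', h1, h2.trans ?_⟩
      change ((bufferState C ρ acts s).ensure (acts s)).time = _
      rw [he]
    · have hfix : mulRead Sin ρ ω st = st := by simp [mulRead, hne]
      rw [hfix]
      exact ih h

/-- After `t` time-steps, the simulated play has reached a step at which the buffer of the current
action is empty and `t` plays have been made. -/
theorem exists_matches_mulStateAt (t : ℕ) :
    ∃ s, Matches ρ ω η (mulStateAt I Sin ρ C ω η t) s (bufferState C ρ acts s) ∧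
      (bufferState C ρ acts s).time = t := by
  induction t with
  | zero => exact ⟨0, ⟨rfl, rfl, rfl, fun y a ha => absurd ha (by simp [bufferState])⟩, rfl⟩
  | succ t ih =>
    obtain ⟨s, h, ht⟩ := ih
    have hemp := mulStateAt_avail_cur I Sin ρ C ω η t
    rw [mulStateAt_succ]
    set st := mulStateAt I Sin ρ C ω η t
    have hemp' : (bufferState C ρ acts s).avail (acts s) = ∅ := by
      rwa [h.avail, h.cur] at hemp
    have he := BufferState.ensure_of_empty hemp'
    set st' := mulReplenish st fun a => I.meanReward st.cur + η (a, t) with hst'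
    have hm : Matches ρ ω η st' s ((bufferState C ρ acts s).ensure (acts s)) := by
      rw [he]
      refine ⟨h.hist, h.cur, ?_, fun y a ha => ?_⟩
      · simp only [hst', mulReplenish, BufferState.play, h.avail, h.cur]
      · simp only [hst', mulReplenish, BufferState.play, h.cur, ht] at ha ⊢
        by_cases hy : y = acts s
        · subst hy; simp
        · simp only [Function.update_of_ne hy] at ha ⊢
          exact h.reward y a ha
    have hne : (st'.avail st'.cur).Nonempty := by
      rw [hm.avail, hm.cur]
      exact BufferState.ensure_avail_nonempty _ _
    -- The first reading is split off: just after the refill the state matches the `ensure`d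
    -- buffers, and only after one reading does it match a `bufferState` again.
    have hsize := mulRead_of_nonempty Sin ρ ω st' hne
    rw [mulDrain, ← hsize, Function.iterate_succ_apply]
    obtain ⟨s', h1, h2⟩ := hm.read.iterate_read (mulBufferSize (mulRead Sin ρ ω st'))
    refine ⟨s', h1, h2.trans ?_⟩
    change ((bufferState C ρ acts s).ensure (acts s)).time = _
    rw [he, ← ht]
    rfl

/-- The action played at time `t`, in terms of the simulated play. -/
theorem mulStateAt_cur_eq_iff (t : ℕ) (y : I.X) :
    (mulStateAt I Sin ρ C ω η t).cur = y ↔ ∃ s, (bufferState C ρ acts s).time = t ∧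
      (bufferState C ρ acts s).avail (acts s) = ∅ ∧ acts s = y := by
  obtain ⟨s, h, ht⟩ := exists_matches_mulStateAt (I := I) (ρ := ρ) (C := C) (ω := ω) (η := η) t
  have hemp := mulStateAt_avail_cur I Sin ρ C ω η t
  rw [h.avail, h.cur] at hemp
  rw [h.cur]
  constructor
  · exact fun e => ⟨s, ht, hemp, e⟩
  · rintro ⟨s', ht', hemp', e⟩
    rwa [bufferState_step_unique ρ acts (ht.trans ht'.symm) hemp hemp']

end Matching

/-! ### Conservation of plays -/

/-- The total of `f` over the actions of the simulated history and of the buffered rewards. -/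
def mulPotential {X : Finset (EuclideanSpace ℝ (Fin d))} {C : Finset A} (f : X → ℝ)
    (st : MulState X C) : ℝ :=
  (st.hist.map fun u => f u.1).sum + ∑ y, ((st.avail y).card : ℝ) * f y

open Classical in
theorem sum_card_update {X : Finset (EuclideanSpace ℝ (Fin d))} {C : Finset A} (f : X → ℝ)
    (avail : X → Finset C) (x : X) (B : Finset C) :
    ∑ y, ((Function.update avail x B y).card : ℝ) * f y
      = ∑ y, ((avail y).card : ℝ) * f y + (B.card - (avail x).card) * f x := by
  rw [← Finset.add_sum_erase _ _ (Finset.mem_univ x),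
    ← Finset.add_sum_erase _ (fun y => ((avail y).card : ℝ) * f y) (Finset.mem_univ x),
    Finset.sum_congr rfl fun y hy => by
      rw [Function.update_of_ne (Finset.ne_of_mem_erase hy)],
    Function.update_self]
  ring

open Classical in
theorem mulPotential_read {C : Finset A} (f : I.X → ℝ) (ρ : RemovalRule A I.X) (ω : Sin.Seed)
    (st : MulState I.X C) : mulPotential f (mulRead Sin ρ ω st) = mulPotential f st := by
  by_cases hs : (st.avail st.cur).Nonempty
  · have hcard := Finset.card_erase_add_one
      (ρ C st.hist.length st.cur (st.avail st.cur) hs).2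
    simp only [mulPotential, mulRead, hs, dif_pos, List.map_append, List.map_cons, List.map_nil,
      List.sum_append, List.sum_singleton]
    rw [sum_card_update, ← hcard]
    push_cast
    ring
  · simp [mulRead, hs]

open Classical in
theorem mulPotential_replenish {C : Finset A} (f : I.X → ℝ) (st : MulState I.X C) (y : C → ℝ)
    (h : st.avail st.cur = ∅) :
    mulPotential f (mulReplenish st y) = mulPotential f st + C.card * f st.cur := by
  simp only [mulPotential, mulReplenish]
  rw [sum_card_update, h, Finset.card_univ, Fintype.card_coe, Finset.card_empty]
  push_cast
  ring

/-- Conservation law: a refill of an empty buffer adds `|C|` copies of the current action, and a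
reading only moves one copy from buffer to history. It is used for `f = 1` and for `f` the gap. -/
theorem mulPotential_mulStateAt (f : I.X → ℝ) (ρ : RemovalRule A I.X) (C : Finset A) (ω : Sin.Seed)
    (η : A × ℕ → ℝ) (t : ℕ) :
    mulPotential f (mulStateAt I Sin ρ C ω η t)
      = C.card * ∑ k ∈ Finset.range t, f (mulStateAt I Sin ρ C ω η k).cur := by
  induction t with
  | zero => simp [mulPotential, mulStateAt, mulState, coalitionHistory, mulInit]
  | succ t ih =>
    have hdrain : ∀ (k : ℕ) (st : MulState I.X C),
        mulPotential f ((mulRead Sin ρ ω)^[k] st) = mulPotential f st := by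
      intro k
      induction k with
      | zero => exact fun _ => rfl
      | succ k ihk =>
        intro st
        rw [Function.iterate_succ_apply, ihk, mulPotential_read]
    rw [mulStateAt_succ, mulDrain, hdrain,
      mulPotential_replenish I f _ _ (mulStateAt_avail_cur I Sin ρ C ω η t), ih,
      Finset.sum_range_succ, mul_add]

end Simulation

/-! ### The regret of the meta-algorithm -/

namespace FixedInstance

variable {d : ℕ} (I : FixedInstance d)

/-- The sub-optimality gap of an action. -/
def gap (x : I.X) : ℝ := I.optReward - I.meanReward x

theorem gap_nonneg (x : I.X) : 0 ≤ I.gap x := sub_nonneg.mpr (Finset.le_sup' I.meanReward x.2)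

theorem gap_le_maxGap (x : I.X) : I.gap x ≤ I.maxGap :=
  Finset.le_sup' (fun x => I.optReward - I.meanReward x) x.2

theorem maxGap_nonneg : 0 ≤ I.maxGap :=
  I.X_nonempty.elim fun x hx => (I.gap_nonneg ⟨x, hx⟩).trans (I.gap_le_maxGap ⟨x, hx⟩)

end FixedInstance

section Regret

variable {d : ℕ} {A : Type*} (I : FixedInstance d) (Sin : SingleAgentAlgorithm I.X)

/-- Along every run, the regret of the coalition differs from that of the simulated play by at most
one full set of buffers. -/
theorem abs_sum_gap_sub_le (ρ : RemovalRule A I.X) (C : Finset A) [Nonempty C] (ω : Sin.Seed)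
    (η : A × ℕ → ℝ) (T : ℕ) :
    |C.card * ∑ k ∈ Finset.range T, I.gap (mulStateAt I Sin ρ C ω η k).cur
      - ∑ s ∈ Finset.range (C.card * T), I.gap (simAction I Sin ω (simNoise I Sin ρ C ω η) s)|
      ≤ C.card * I.X.card * I.maxGap := by
  obtain ⟨s, h, -⟩ := exists_matches_mulStateAt (I := I) (ρ := ρ) (C := C) (ω := ω) (η := η) T
  have hgap := mulPotential_mulStateAt I Sin I.gap ρ C ω η T
  have hone := mulPotential_mulStateAt I Sin (fun _ => 1) ρ C ω η T
  set st := mulStateAt I Sin ρ C ω η T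
  set x := simAction I Sin ω (simNoise I Sin ρ C ω η)
  rw [← hgap]
  rw [mulPotential, h.hist, sum_singleHistory I Sin ω _ fun _ => (1 : ℝ)] at hone
  rw [mulPotential, h.hist, sum_singleHistory]
  simp only [Finset.sum_const, Finset.card_range, nsmul_eq_mul, mul_one] at hone
  -- By `hone`, `s + L = |C| T`: the number of buffered rewards is exactly the number of steps by
  -- which the simulated play lags behind.
  set L : ℝ := ∑ y, ((st.avail y).card : ℝ) with hL
  have hLle : L ≤ C.card * I.X.card := by
    calc L ≤ ∑ _y : I.X, (C.card : ℝ) := Finset.sum_le_sum fun y _ => by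
          exact_mod_cast (Finset.card_le_univ _).trans_eq (Fintype.card_coe C)
      _ = C.card * I.X.card := by
          rw [Finset.sum_const, Finset.card_univ, Fintype.card_coe, nsmul_eq_mul, mul_comm]
  have hL0 : 0 ≤ L := Finset.sum_nonneg fun _ _ => Nat.cast_nonneg _
  have hsle : s ≤ C.card * T := by
    have : (s : ℝ) ≤ C.card * T := by linarith
    exact_mod_cast this
  have hbuf : ∑ y, ((st.avail y).card : ℝ) * I.gap y ≤ L * I.maxGap := by
    rw [hL, Finset.sum_mul]
    exact Finset.sum_le_sum fun y _ =>
      mul_le_mul_of_nonneg_left (I.gap_le_maxGap y) (Nat.cast_nonneg _)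
  have hbuf0 : 0 ≤ ∑ y, ((st.avail y).card : ℝ) * I.gap y :=
    Finset.sum_nonneg fun y _ => mul_nonneg (Nat.cast_nonneg _) (I.gap_nonneg y)
  have hrest : ∑ r ∈ Finset.Ico s (C.card * T), I.gap (x r) ≤ L * I.maxGap := by
    have := Finset.sum_le_card_nsmul (Finset.Ico s (C.card * T)) (fun r => I.gap (x r)) I.maxGap
      fun r _ => I.gap_le_maxGap _
    rw [Nat.card_Ico, nsmul_eq_mul, Nat.cast_sub hsle, Nat.cast_mul] at this
    rwa [show (C.card : ℝ) * T - s = L by linarith] at this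
  have hrest0 : 0 ≤ ∑ r ∈ Finset.Ico s (C.card * T), I.gap (x r) :=
    Finset.sum_nonneg fun r _ => I.gap_nonneg _
  have hle := mul_le_mul_of_nonneg_right hLle I.maxGap_nonneg
  -- The first `s` gaps cancel. What remains is the buffered gap minus the gap of the missing steps;
  -- both lie in `[0, L Δ]`, so the bound needs no factor `2`.
  rw [← Finset.sum_range_add_sum_Ico _ hsle, abs_le]
  constructor <;> linarith

theorem singleHistory_eq_ofFn (ω : Sin.Seed) (ξ : ℕ → ℝ) (s : ℕ) :
    singleHistory I Sin ω ξ s = List.ofFn fun i : Fin s =>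
      (simAction I Sin ω ξ i, I.meanReward (simAction I Sin ω ξ i) + ξ i) := by
  induction s with
  | zero => rfl
  | succ s ih =>
    rw [List.ofFn_succ', List.concat_eq_append]
    simp only [Fin.val_castSucc, Fin.val_last]
    rw [← ih]
    rfl

theorem measurable_simAction (s : ℕ) :
    Measurable fun u : Sin.Seed × (ℕ → ℝ) => simAction I Sin u.1 u.2 s := by
  induction s using Nat.strong_induction_on with
  | _ s ih =>
    change Measurable fun u : Sin.Seed × (ℕ → ℝ) => Sin.act u.1 (singleHistory I Sin u.1 u.2 s)
    simp only [singleHistory_eq_ofFn]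
    refine (Sin.measurable_act s).comp (measurable_fst.prodMk (measurable_pi_lambda _ fun i => ?_))
    refine (ih i i.2).prodMk (Measurable.add ?_ ?_)
    · exact (measurable_of_countable fun x : I.X => I.meanReward x).comp (ih i i.2)
    · exact (measurable_pi_apply _).comp measurable_snd

/-- A function of finitely many actions of the simulated play is measurable. -/
theorem measurable_comp_simAction {β : Type*} [MeasurableSpace β] (G : (ℕ → I.X) → β) (n : ℕ)
    (hG : ∀ x x' : ℕ → I.X, (∀ r < n, x r = x' r) → G x = G x') :
    Measurable fun u : Sin.Seed × (ℕ → ℝ) => G (simAction I Sin u.1 u.2) := by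
  have : Nonempty I.X := I.X_nonempty.to_subtype
  have h1 : Measurable fun u : Sin.Seed × (ℕ → ℝ) =>
      fun i : Fin n => simAction I Sin u.1 u.2 i :=
    measurable_pi_lambda _ fun i => measurable_simAction I Sin i
  let G' : (Fin n → I.X) → β := fun z =>
    G fun r => if h : r < n then z ⟨r, h⟩ else Classical.arbitrary _
  have h2 : Measurable G' := measurable_of_countable G'
  convert h2.comp h1 using 2 with u
  refine hG _ _ fun r hr => ?_
  simp [hr]

variable (ρ : RemovalRule A I.X) (C : Finset A)

/-- The seed and the noise terms of the simulated play have the law of those of a run of `Sin`. -/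
theorem measurePreserving_simNoise [Countable A] [Nonempty C] :
    MeasurePreserving (fun u : Sin.Seed × (A × ℕ → ℝ) => (u.1, simNoise I Sin ρ C u.1 u.2))
      (Sin.seedLaw.prod (Measure.infinitePi fun _ : A × ℕ => I.noise))
      (Sin.seedLaw.prod (Measure.infinitePi fun _ : ℕ => I.noise)) := by
  -- On the countable index set the discrete σ-algebra is available; each query depends on finitely
  -- many actions from a finite set, so it is measurable.
  let : MeasurableSpace (A × ℕ) := ⊤
  have : MeasurableSingletonClass (A × ℕ) := ⟨fun _ => trivial⟩
  have hq : ∀ s, Measurable fun u : Sin.Seed × (ℕ → ℝ) => simQuery I Sin ρ C u.1 s u.2 :=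
    fun s => measurable_comp_simAction I Sin (fun x => rewardSource C ρ x s) (s + 1)
      fun x x' h => rewardSource_congr ρ h
  refine (MeasurePreserving.id _).skew_product (g := fun ω η => simNoise I Sin ρ C ω η)
    (measurable_selected hq) (Filter.Eventually.of_forall fun ω => ?_)
  exact map_selected_infinitePi I.noise (fun s => (hq s).comp (measurable_prodMk_left))
    (isCausal_simQuery I Sin ρ C ω) fun ξ r s h => rewardSource_ne ρ _ h

/-- The step of the simulated play that corresponds to time `t` is random. The event is a countable
union over its possible values, each deciding finitely many simulated actions. -/
theorem measurable_mulStateAt_cur [Countable A] [Nonempty C] (t : ℕ) :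
    Measurable fun u : Sin.Seed × (A × ℕ → ℝ) => (mulStateAt I Sin ρ C u.1 u.2 t).cur := by
  refine measurable_to_countable' fun y => ?_
  have hset : (fun u : Sin.Seed × (A × ℕ → ℝ) => (mulStateAt I Sin ρ C u.1 u.2 t).cur) ⁻¹' {y}
      = (fun u : Sin.Seed × (A × ℕ → ℝ) => (u.1, simNoise I Sin ρ C u.1 u.2)) ⁻¹'
        ⋃ s, {u | (bufferState C ρ (simAction I Sin u.1 u.2) s).time = t ∧
          (bufferState C ρ (simAction I Sin u.1 u.2) s).avail (simAction I Sin u.1 u.2 s) = ∅ ∧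
          simAction I Sin u.1 u.2 s = y} := by
    ext u
    simp only [Set.mem_preimage, Set.mem_singleton_iff, mulStateAt_cur_eq_iff, Set.mem_iUnion,
      Set.mem_ofPred_eq]
  rw [hset]
  refine (measurePreserving_simNoise I Sin ρ C).measurable (MeasurableSet.iUnion fun s => ?_)
  have := measurable_comp_simAction I Sin (fun x => (bufferState C ρ x s).time = t ∧
    (bufferState C ρ x s).avail (x s) = ∅ ∧ x s = y) (s + 1) fun x x' h => by
      rw [bufferState_congr ρ fun r hr => h r (by omega), h s (by omega)]
  exact measurableSet_setOfPred.mpr this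

theorem integrable_comp_action {Ω : Type*} [MeasurableSpace Ω] {P : Measure Ω} [IsFiniteMeasure P]
    {g : Ω → I.X} (hg : Measurable g) (f : I.X → ℝ) : Integrable (fun u => f (g u)) P :=
  Integrable.comp_measurable (g := f) Integrable.of_finite hg

theorem integral_gap {Ω : Type*} [MeasurableSpace Ω] {P : Measure Ω} [IsProbabilityMeasure P]
    {g : Ω → I.X} (hg : Measurable g) :
    ∫ u, I.gap (g u) ∂P = I.optReward - ∫ u, I.meanReward (g u) ∂P := by
  simp only [FixedInstance.gap]
  rw [integral_sub (integrable_const _) (integrable_comp_action I hg fun x => I.meanReward x),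
    integral_const, probReal_univ, one_smul]

/-- The regret of `Sin`, in terms of the simulated play of the meta-algorithm. -/
theorem singleRegret_eq_integral [Countable A] [Nonempty C] (N : ℕ) :
    singleRegret I Sin N = ∫ u : Sin.Seed × (A × ℕ → ℝ),
      ∑ s ∈ Finset.range N, I.gap (simAction I Sin u.1 (simNoise I Sin ρ C u.1 u.2) s)
        ∂(Sin.seedLaw.prod (Measure.infinitePi fun _ : A × ℕ => I.noise)) := by
  have hΨ := measurePreserving_simNoise I Sin ρ C
  have hint := fun s => integrable_comp_action I
    (P := Sin.seedLaw.prod (Measure.infinitePi fun _ : ℕ => I.noise))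
    (measurable_simAction I Sin s) I.gap
  have h1 : singleRegret I Sin N = ∫ u : Sin.Seed × (ℕ → ℝ),
      ∑ s ∈ Finset.range N, I.gap (simAction I Sin u.1 u.2 s)
        ∂(Sin.seedLaw.prod (Measure.infinitePi fun _ : ℕ => I.noise)) := by
    rw [integral_finsetSum _ fun s _ => hint s]
    exact Finset.sum_congr rfl fun s _ => (integral_gap I (measurable_simAction I Sin s)).symm
  rw [h1, ← hΨ.map_eq, integral_map hΨ.measurable.aemeasurable]
  rw [hΨ.map_eq]
  exact (integrable_finsetSum _ fun s _ => hint s).aestronglyMeasurable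

theorem neg_collaborationValue_eq_integral [Countable A] [Nonempty C] (T : ℕ) :
    -collaborationValue I (mulAlgorithm Sin ρ) T C = ∫ u : Sin.Seed × (A × ℕ → ℝ),
      C.card * ∑ k ∈ Finset.range T, I.gap (mulStateAt I Sin ρ C u.1 u.2 k).cur
        ∂(Sin.seedLaw.prod (Measure.infinitePi fun _ : A × ℕ => I.noise)) := by
  have hm := measurable_mulStateAt_cur I Sin ρ C
  have hreg : ∀ a : C, regret I (mulAlgorithm Sin ρ) C a T
      = ∫ u : Sin.Seed × (A × ℕ → ℝ),
        ∑ k ∈ Finset.range T, I.gap (mulStateAt I Sin ρ C u.1 u.2 k).cur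
          ∂(Sin.seedLaw.prod (Measure.infinitePi fun _ : A × ℕ => I.noise)) := by
    intro a
    rw [integral_finsetSum _ fun k _ => integrable_comp_action I (hm k) I.gap]
    exact Finset.sum_congr rfl fun k _ => (integral_gap I
      (P := Sin.seedLaw.prod (Measure.infinitePi fun _ : A × ℕ => I.noise)) (hm k)).symm
  rw [collaborationValue, neg_neg, Finset.sum_congr rfl fun a _ => hreg a, Finset.sum_const,
    Finset.card_univ, Fintype.card_coe, nsmul_eq_mul, integral_const_mul]

/-- The value of a coalition is minus the regret of `Sin` over as many steps as there are plays, up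
to one full set of buffers. -/
theorem abs_collaborationValue_add_singleRegret_le [Countable A] (T : ℕ) :
    |collaborationValue I (mulAlgorithm Sin ρ) T C + singleRegret I Sin (C.card * T)|
      ≤ C.card * I.X.card * I.maxGap := by
  rcases C.eq_empty_or_nonempty with rfl | hC
  · simp [collaborationValue, singleRegret]
  have : Nonempty C := hC.to_subtype
  have hΨ := measurePreserving_simNoise I Sin ρ C
  rw [← abs_neg, neg_add, ← sub_eq_add_neg, neg_collaborationValue_eq_integral,
    singleRegret_eq_integral I Sin ρ C, ← integral_sub]
  · have hb := norm_integral_le_of_norm_le_const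
      (μ := Sin.seedLaw.prod (Measure.infinitePi fun _ : A × ℕ => I.noise))
      (Filter.Eventually.of_forall fun u => (Real.norm_eq_abs _).trans_le
        (abs_sum_gap_sub_le I Sin ρ C u.1 u.2 T))
    rwa [probReal_univ, mul_one, Real.norm_eq_abs] at hb
  · exact (integrable_finsetSum _ fun k _ =>
      integrable_comp_action I (measurable_mulStateAt_cur I Sin ρ C k) I.gap).const_mul _
  · exact integrable_finsetSum _ fun s _ => integrable_comp_action I
      ((measurable_simAction I Sin s).comp hΨ.measurable) I.gap

open Classical in
/-- Under the assumptions on the regret of `Sin`, the collaboration game is convex. -/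
theorem collaborationValue_convex [Fintype A] (T : ℕ) {υ : ℕ → ℝ} {c ε : ℝ}
    (hSin : RegretRate (singleRegret I Sin) (Fintype.card A * T) υ c ε)
    (hT : ∀ t : ℕ, t + 2 ≤ Fintype.card A * T →
      √(4 * Fintype.card A * I.X.card * I.maxGap / υ t) ≤ (T : ℝ))
    (S : Finset A) (i j : A) (hi : i ∉ S) (hj : j ∉ S) (hij : i ≠ j) :
    collaborationValue I (mulAlgorithm Sin ρ) T (insert i S)
        + collaborationValue I (mulAlgorithm Sin ρ) T (insert j S)
      ≤ collaborationValue I (mulAlgorithm Sin ρ) T (insert i (insert j S))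
        + collaborationValue I (mulAlgorithm Sin ρ) T S := by
  -- Concavity is available only for positive increments; at `T = 0` all values vanish.
  rcases Nat.eq_zero_or_pos T with rfl | hTpos
  · simp [collaborationValue, regret]
  have hci := Finset.card_insert_of_notMem hi
  have hcj := Finset.card_insert_of_notMem hj
  have hcij : (insert i (insert j S)).card = S.card + 2 := by
    rw [Finset.card_insert_of_notMem (by simp [hij, hi]), hcj]
  have hM : S.card + 2 ≤ Fintype.card A := hcij ▸ Finset.card_le_univ _
  have b0 := abs_le.mp (abs_collaborationValue_add_singleRegret_le I Sin ρ S T)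
  have bi := abs_le.mp (abs_collaborationValue_add_singleRegret_le I Sin ρ (insert i S) T)
  have bj := abs_le.mp (abs_collaborationValue_add_singleRegret_le I Sin ρ (insert j S) T)
  have bij := abs_le.mp
    (abs_collaborationValue_add_singleRegret_le I Sin ρ (insert i (insert j S)) T)
  rw [hci] at bi
  rw [hcj] at bj
  rw [hcij] at bij
  set t := S.card * T with ht
  have e1 : (S.card + 1) * T = t + T := by ring
  have e2 : (S.card + 2) * T = t + T + T := by ring
  have htN : t + T + T ≤ Fintype.card A * T := e2 ▸ Nat.mul_le_mul_right T hM
  rw [e1] at bi bj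
  rw [e2] at bij
  have hυ := hSin.υ_pos t (by omega)
  have hconc := hSin.strict_concavity t T T hTpos hTpos htN
  have hbig := (Real.sqrt_le_iff.mp (hT t (by omega))).2
  rw [div_le_iff₀ hυ] at hbig
  have hTr : (0 : ℝ) < T := Nat.cast_pos.mpr hTpos
  rw [discreteDeriv₂, discreteDeriv, discreteDeriv, ← sub_div, div_div, div_le_iff₀ (by positivity)]
    at hconc
  have hMr : (S.card : ℝ) + 2 ≤ Fintype.card A := by exact_mod_cast hM
  have hKΔ : 0 ≤ (I.X.card : ℝ) * I.maxGap := mul_nonneg (Nat.cast_nonneg _) I.maxGap_nonneg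
  -- The coalition sizes add up to `|S| + 2 (|S| + 1) + (|S| + 2) = 4 (|S| + 1)`, which is where the
  -- constant `4 M` in the bound on `T` comes from.
  have herr := mul_le_mul_of_nonneg_right hMr hKΔ
  push_cast at bi bj bij
  nlinarith [bi.2, bj.2, bij.1, b0.1]

end Regret

end

theorem mainTheorem3 {A : Type*} [Fintype A] {d : ℕ} (I : FixedInstance d)
    (Sin : SingleAgentAlgorithm I.X) (ρ : RemovalRule A I.X) (T : ℕ)
    (υ : ℕ → ℝ) (c ε : ℝ)
    (hSin : RegretRate (singleRegret I Sin) (Fintype.card A * T) υ c ε)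
    (hT : ∀ t : ℕ, t + 2 ≤ Fintype.card A * T →
      √(4 * Fintype.card A * I.X.card * I.maxGap / υ t) ≤ (T : ℝ)) :
    (core (collaborationValue I (mulAlgorithm Sin ρ) T)).Nonempty ∧
      shapleyValue (collaborationValue I (mulAlgorithm Sin ρ) T) ∈
        core (collaborationValue I (mulAlgorithm Sin ρ) T) := by
  have h := shapleyValue_mem_core (by simp [collaborationValue])
    (collaborationValue_convex I Sin ρ T hSin hT)
  exact ⟨⟨_, h⟩, h⟩
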